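/- For integers $n,d\ge 1$ let $\mathbb{C}[x_0,\dots,x_n]_d$ be the space of complex forms of degree $d$, and for $e\ge 1$ let $V^n_e=\{[L^e] : L \text{ a nonzero linear form}\}\subset\mathbb{P}(\mathbb{C}[x_0,\dots,x_n]_e)$ be the Veronese variety. A *decomposition of length $h$* of $F\in\mathbb{C}[x_0,\dots,x_n]_d$ is an expression $F=\lambda_1L_1^d+\dots+\lambda_hL_h^d$ with $\lambda_i\in\mathbb{C}^*$, $L_i$ linear forms, and $L_1^d,\dots,L_h^d$ linearly independent. $F$ is *$h$-identifiable* if it has a decomposition of length $h$ and any two such decompositions agree up to permuting the summands and rescaling the $L_i$ (with the corresponding change of the $\lambda_i$). **Theorem.** Let $(n,d,h,s)$ be $(1,2h-1,h,h-2)$ with $h\ge 2$, or $(2,5,7,2)$, or $(3,3,5,1)$. Let $F\in\mathbb{C}[x_0,\dots,x_n]_d$ be a form that admits a decomposition of length $h$, and let $H_{\partial,s}\subseteq\mathbb{P}(\mathbb{C}[x_0,\dots,x_n]_{d-s})$ be the linear span of its partial derivatives of order $s$. Assume that - $H_{\partial,s}$ has (projective) dimension $\binom{n+s}{n}-1$,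 and - $H_{\partial,s}\cap V^n_{d-s}=\emptyset$. Then $F$ is $h$-identifiable. -/

import Mathlib

namespace WaringIdentifiability

/-- The vector space `ℂ[x₀, …, xₙ]_d` of complex forms of degree `d` in `n + 1` variables
(the zero form included). -/
abbrev Forms (n d : ℕ) : Submodule ℂ (MvPolynomial (Fin (n + 1)) ℂ) :=
  MvPolynomial.homogeneousSubmodule (Fin (n + 1)) ℂ d

/-- The iterated partial derivative `∂/∂x_{i₁} ⋯ ∂/∂x_{iₛ} F` for the word `[i₁, …, iₛ]`. -/
noncomputable def iterPartial {n : ℕ} (w : List (Fin (n + 1)))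
    (F : MvPolynomial (Fin (n + 1)) ℂ) : MvPolynomial (Fin (n + 1)) ℂ :=
  w.foldr (fun i G => MvPolynomial.pderiv i G) F

/-- The vector space spanned by all partial derivatives of order `s` of `F`. -/
noncomputable def partialSpan {n : ℕ} (F : MvPolynomial (Fin (n + 1)) ℂ) (s : ℕ) :
    Submodule ℂ (MvPolynomial (Fin (n + 1)) ℂ) :=
  Submodule.span ℂ {G | ∃ w : List (Fin (n + 1)), w.length = s ∧ G = iterPartial w F}

/-- The linear subspace of `ℙ(ℂ[x₀, …, xₙ]_e)` defined by the span of the partial derivatives of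
order `s` of `F`, as a set of points; used with `e = d - s` for `F` of degree `d`. -/
def partialLinearSpace {n : ℕ} (F : MvPolynomial (Fin (n + 1)) ℂ) (s e : ℕ) :
    Set (Projectivization ℂ (Forms n e)) :=
  {p | p.submodule ≤ (partialSpan F s).comap (Forms n e).subtype}

/-- The `e`-th power of a linear form, as a form of degree `e`. -/
noncomputable def powForm {n : ℕ} (e : ℕ) (L : Forms n 1) : Forms n e :=
  ⟨(L : MvPolynomial (Fin (n + 1)) ℂ) ^ e, by
    have h := L.2
    rw [MvPolynomial.mem_homogeneousSubmodule] at h ⊢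
    simpa using h.pow e⟩

theorem powForm_ne_zero {n : ℕ} (e : ℕ) {L : Forms n 1} (hL : L ≠ 0) : powForm e L ≠ 0 := by
  intro h
  have h' : (L : MvPolynomial (Fin (n + 1)) ℂ) ^ e = 0 := congrArg Subtype.val h
  exact pow_ne_zero e (fun h0 => hL (Subtype.ext h0)) h'

/-- The Veronese map `ℙ(ℂ[x₀, …, xₙ]_1) → ℙ(ℂ[x₀, …, xₙ]_e)`, `[L] ↦ [L ^ e]`. -/
noncomputable def veroneseMap (n e : ℕ) :
    Projectivization ℂ (Forms n 1) → Projectivization ℂ (Forms n e) :=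
  Projectivization.lift
    (fun L => Projectivization.mk ℂ (powForm e L.1) (powForm_ne_zero e L.2)) (by
      intro a b t hab
      rw [Projectivization.mk_eq_mk_iff']
      refine ⟨t ^ e, Subtype.ext ?_⟩
      simp [powForm, hab, smul_pow])

/-- The Veronese variety `V^n_e ⊆ ℙ(ℂ[x₀, …, xₙ]_e)`: the set of points `[L ^ e]`. -/
def veronese (n e : ℕ) : Set (Projectivization ℂ (Forms n e)) :=
  Set.range (veroneseMap n e)

/-- A decomposition `F = λ₁ L₁ ^ d + ⋯ + λₕ Lₕ ^ d` of a form `F` of degree `d`, with nonzero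
scalars `λᵢ`, linear forms `Lᵢ`, and linearly independent rank one tensors `Lᵢ ^ d`. -/
structure Decomposition {n : ℕ} (F : MvPolynomial (Fin (n + 1)) ℂ) (d h : ℕ) where
  coeff : Fin h → ℂ
  form : Fin h → Forms n 1
  coeff_ne_zero : ∀ i, coeff i ≠ 0
  linearIndependent : LinearIndependent ℂ (fun i => powForm d (form i))
  eq_sum : F = ∑ i, coeff i • (form i : MvPolynomial (Fin (n + 1)) ℂ) ^ d

/-- Two decompositions agree up to a permutation of the summands and rescaling of the linear
forms (with the scalars rescaled accordingly). -/
def Decomposition.Equivalent {n d h : ℕ} {F : MvPolynomial (Fin (n + 1)) ℂ}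
    (D E : Decomposition F d h) : Prop :=
  ∃ σ : Equiv.Perm (Fin h), ∀ i, ∃ c : ℂ, c ≠ 0 ∧
    E.form (σ i) = c • D.form i ∧ D.coeff i = E.coeff (σ i) * c ^ d

/-- `F` is `h`-identifiable: it has a decomposition with `h` summands, and only one up to
permutation and scaling. -/
def IsIdentifiable {n : ℕ} (F : MvPolynomial (Fin (n + 1)) ℂ) (d h : ℕ) : Prop :=
  Nonempty (Decomposition F d h) ∧ ∀ D E : Decomposition F d h, D.Equivalent E

end WaringIdentifiability

/-!
The proof is elementary and works with the coefficient vectors `p i` of the linear forms of a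
decomposition `F = ∑ λᵢ Lᵢ ^ d`.

Up to a nonzero factor, a form `Q` of degree `s`, acting on `F` as a differential operator, gives
`∑ λᵢ Q(p i) Lᵢ ^ (d - s)` (`Decomposition.catalecticant`), so these sums fill the span of the
partial derivatives of order `s`. The dimension hypothesis says that `Q` is determined by this sum,
and the emptiness hypothesis that the sum is never a nonzero multiple of a single `Lᵢ ^ (d - s)`.
Together: no nonzero form of degree `s` vanishes at all but one of the points
(`Decomposition.noFormThroughAllButOne`). In the two sporadic cases the number of points exceeds by
one the dimension of the space of forms of degree `s`, so that evaluations of these forms at the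
points satisfy only one linear relation, with all coefficients nonzero
(`NoFormThroughAllButOne.coeff_eq_zero`).

Given a second decomposition with coefficients `μⱼ` and points `q j`, every form `D` of degree `d`
satisfies `∑ λᵢ D(p i) = ∑ μⱼ D(q j)` (`Decomposition.sum_coeff_mul_eval_eq`). It suffices to show
that the two sets of points of projective space coincide, by choosing `D` suitably
(`Decomposition.equivalent_of_forall_exists`).

* Binary forms of degree `2h - 1`: if `q j` is not among the `p i`, some product of `2h - 1` linear
  forms vanishes at all the points except `q j`.
* Cubics in four variables, `h = 5`: take `D = l * m * m'` with `l` through three of the points `q`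
  and `m` through the other two, `q j` and `q k`. The relation on linear forms
  then shows that the line through `q j` and `q k` contains two of the points `p`. Two such lines
  through `q j` must share one of the `p i`, which is therefore `q j`.
* Plane quintics, `h = 7`: if all cubics through the points `p` vanish at `q j`, then `q j` is one
  of the `p i` (`NoFormThroughAllButOne.eq_smul_of_vanishing`). Otherwise some cubic `B` through the
  `p i` does not vanish at `q j`, and by the relation on conics it vanishes at none of the points
  `q`; for the same reason, cubics through all `p i` and one `q k` pass through all the points `q`,
  and there are two independent ones, `A₁` and `A₂`. The quartics through the `p i` form a space of
  dimension `8 < 9`, so there is a linear syzygy between `A₁`, `A₂` and `B`. The coefficient of `B`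
  vanishes at the points `q`, hence is zero. The syzygy between `A₁` and `A₂` forces them to share
  a conic, which passes through all the `p i` but at most one, a contradiction.
-/

namespace WaringIdentifiability

open MvPolynomial Module

/-! ### Forms, evaluation functionals and points in general position -/

theorem forms_eq_span_monomial (n e : ℕ) :
    Forms n e = Submodule.span ℂ
      ((fun α : Fin (n + 1) →₀ ℕ => monomial α (1 : ℂ)) '' {α | α.degree = e}) := by
  have h := homogeneousSubmodule_eq_finsupp_supported (Fin (n + 1)) ℂ e
  rw [Forms, h]
  exact restrictSupport_eq_span ℂ _

instance finite_forms (n e : ℕ) : Module.Finite ℂ (Forms n e) :=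
  Module.Finite.iff_fg.mpr (homogeneousSubmodule_fg (Fin (n + 1)) ℂ e)

theorem finrank_forms (n e : ℕ) : finrank ℂ (Forms n e) = (n + e).choose n := by
  have h := homogeneousSubmodule_eq_finsupp_supported (Fin (n + 1)) ℂ e
  let b : Basis {α : Fin (n + 1) →₀ ℕ | α.degree = e} ℂ (Forms n e) :=
    (basisRestrictSupport ℂ {α : Fin (n + 1) →₀ ℕ | α.degree = e}).map
      (LinearEquiv.ofEq _ _ h.symm)
  rw [finrank_eq_nat_card_basis b]
  have hset : {α : Fin (n + 1) →₀ ℕ | α.degree = e} =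
      (Finset.finsuppAntidiag (Finset.univ : Finset (Fin (n + 1))) e : Set _) := by
    ext α
    simp [Finset.mem_finsuppAntidiag, Finsupp.degree_eq_sum]
  rw [hset, Nat.card_coe_set_eq, Set.ncard_coe_finset, Finset.card_finsuppAntidiag_nat_eq_choose]
  rw [Finset.card_univ, Fintype.card_fin, show n + 1 + e - 1 = n + e by omega, Nat.choose_symm_add]

/-- Evaluation of forms of degree `e` at a vector, as a linear functional. -/
noncomputable def formEval {n : ℕ} (e : ℕ) (x : Fin (n + 1) → ℂ) : Forms n e →ₗ[ℂ] ℂ :=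
  (aeval x).toLinearMap ∘ₗ (Forms n e).subtype

@[simp]
theorem formEval_apply {n e : ℕ} (x : Fin (n + 1) → ℂ) (D : Forms n e) :
    formEval e x D = eval x (D : MvPolynomial (Fin (n + 1)) ℂ) := by
  simp [formEval, aeval_eq_eval]

theorem exists_form_vanishing {n : ℕ} {ι : Type*} [Fintype ι] (e : ℕ) (x : ι → Fin (n + 1) → ℂ)
    (h : Fintype.card ι < (n + e).choose n) :
    ∃ D : MvPolynomial (Fin (n + 1)) ℂ, D.IsHomogeneous e ∧ D ≠ 0 ∧ ∀ i, eval (x i) D = 0 := by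
  have hker : LinearMap.ker (LinearMap.pi fun i => formEval e (x i)) ≠ ⊥ :=
    LinearMap.ker_ne_bot_of_finrank_lt (by rwa [finrank_fintype_fun_eq_card, finrank_forms])
  obtain ⟨D, hD, hD0⟩ := Submodule.exists_mem_ne_zero_of_ne_bot hker
  refine ⟨D, D.2, fun h0 => hD0 (Subtype.ext h0), fun i => ?_⟩
  simpa using congrFun (LinearMap.mem_ker.mp hD) i

theorem exists_eval_eq_sum_of_vanishing {n : ℕ} {ι : Type*} [Fintype ι] {e : ℕ}
    {p : ι → Fin (n + 1) → ℂ} {q : Fin (n + 1) → ℂ}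
    (h : ∀ D : MvPolynomial (Fin (n + 1)) ℂ, D.IsHomogeneous e → (∀ i, eval (p i) D = 0) →
      eval q D = 0) :
    ∃ c : ι → ℂ, ∀ D : MvPolynomial (Fin (n + 1)) ℂ, D.IsHomogeneous e →
      eval q D = ∑ i, c i * eval (p i) D := by
  have hmem : formEval e q ∈ Submodule.span ℂ (Set.range fun i => formEval e (p i)) := by
    refine mem_span_of_iInf_ker_le_ker fun D hD => ?_
    rw [Submodule.mem_iInf] at hD
    simpa using h D D.2 fun i => by simpa using hD i
  obtain ⟨c, hc⟩ := (Submodule.mem_span_range_iff_exists_fun ℂ).mp hmem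
  refine ⟨c, fun D hD => ?_⟩
  simpa using (LinearMap.congr_fun hc ⟨D, hD⟩).symm

theorem exists_eq_smul_add_smul {n : ℕ} {a b x : Fin (n + 1) → ℂ}
    (h : ∀ l : MvPolynomial (Fin (n + 1)) ℂ, l.IsHomogeneous 1 → eval a l = 0 → eval b l = 0 →
      eval x l = 0) :
    ∃ α β : ℂ, x = α • a + β • b := by
  obtain ⟨c, hc⟩ := exists_eval_eq_sum_of_vanishing (p := ![a, b]) (q := x) (e := 1)
    fun D hD hp => h D hD (hp 0) (hp 1)
  refine ⟨c 0, c 1, funext fun i => ?_⟩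
  simpa [Fin.sum_univ_two] using hc (X i) (isHomogeneous_X ℂ i)

theorem exists_linear_form_separating {n : ℕ} {a x : Fin (n + 1) → ℂ} (h : ∀ c : ℂ, x ≠ c • a) :
    ∃ l : MvPolynomial (Fin (n + 1)) ℂ, l.IsHomogeneous 1 ∧ eval a l = 0 ∧ eval x l ≠ 0 := by
  by_contra! hl
  obtain ⟨α, β, hx⟩ := exists_eq_smul_add_smul (b := a) fun l h1 h2 _ => hl l h1 h2
  exact h (α + β) (by rw [hx, add_smul])

/-- No nonzero form of degree `s` vanishes at all the points `p i` with at most one exception. -/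
def NoFormThroughAllButOne {n h : ℕ} (s : ℕ) (p : Fin h → Fin (n + 1) → ℂ) : Prop :=
  ∀ (i : Fin h) (Q : MvPolynomial (Fin (n + 1)) ℂ), Q.IsHomogeneous s →
    (∀ k, k ≠ i → eval (p k) Q = 0) → Q = 0

/-- The points other than `p i` and `p k` are too few to prevent a nonzero form of degree `s`
through them; by hypothesis it cannot vanish at `p i` as well. -/
theorem NoFormThroughAllButOne.exists_isolating_form {n h s : ℕ} {p : Fin h → Fin (n + 1) → ℂ}
    (hp : NoFormThroughAllButOne s p) (hcard : h = (n + s).choose n + 1) {i k : Fin h}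
    (hik : i ≠ k) :
    ∃ Q : MvPolynomial (Fin (n + 1)) ℂ, Q.IsHomogeneous s ∧ eval (p i) Q ≠ 0 ∧
      ∀ j, j ≠ i → j ≠ k → eval (p j) Q = 0 := by
  obtain ⟨Q, hQ, hQ0, hQv⟩ := exists_form_vanishing s
    (fun j : {j : Fin h // j ∉ ({i, k} : Finset (Fin h))} => p j) (by
      have : (i : ℕ) ≠ k := Fin.val_ne_of_ne hik
      simp only [Fintype.card_subtype_compl, Fintype.card_fin, Fintype.card_coe,
        Finset.card_pair hik]
      omega)
  have hvan : ∀ j, j ≠ i → j ≠ k → eval (p j) Q = 0 := fun j h1 h2 => hQv ⟨j, by simp [h1, h2]⟩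
  refine ⟨Q, hQ, fun h0 => hQ0 (hp k Q hQ fun j hj => ?_), hvan⟩
  by_cases hji : j = i
  · rw [hji, h0]
  · exact hvan j hji hj

/-- If the number of points exceeds the dimension of the space of forms of degree `s` by one,
evaluations of those forms satisfy exactly one linear relation up to scaling, and none of its
coefficients is zero. -/
theorem NoFormThroughAllButOne.coeff_eq_zero {n h s : ℕ} {p : Fin h → Fin (n + 1) → ℂ}
    (hp : NoFormThroughAllButOne s p) (hcard : h = (n + s).choose n + 1) {c : Fin h → ℂ}
    (hc : ∀ Q : MvPolynomial (Fin (n + 1)) ℂ, Q.IsHomogeneous s → ∑ i, c i * eval (p i) Q = 0)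
    {k : Fin h} (hk : c k = 0) (i : Fin h) : c i = 0 := by
  by_cases hik : i = k
  · rw [hik, hk]
  obtain ⟨Q, hQ, hQi, hvan⟩ := hp.exists_isolating_form hcard hik
  have hsum := hc Q hQ
  rw [Finset.sum_eq_single i] at hsum
  · exact (mul_eq_zero.mp hsum).resolve_right hQi
  · intro j _ hji
    by_cases hjk : j = k
    · rw [hjk, hk, zero_mul]
    · rw [hvan j hji hjk, mul_zero]
  · simp

theorem NoFormThroughAllButOne.ne_zero {n h s : ℕ} {p : Fin h → Fin (n + 1) → ℂ}
    (hp : NoFormThroughAllButOne s p) (hcard : h = (n + s).choose n + 1) (hs : s ≠ 0)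
    (i : Fin h) : p i ≠ 0 := by
  intro h0
  have hpos : 0 < (n + s).choose n := Nat.choose_pos (Nat.le_add_right n s)
  have : Nontrivial (Fin h) := Fin.nontrivial_iff_two_le.mpr (by omega)
  obtain ⟨k, hk⟩ := exists_ne i
  obtain ⟨Q, hQ, hQi, -⟩ := hp.exists_isolating_form hcard hk.symm
  refine hQi ?_
  rw [h0]
  simpa [constantCoeff_eq] using hQ.coeff_eq_zero (d := 0) (by simpa using hs.symm)

theorem eval_smul_add_smul {n : ℕ} {m : MvPolynomial (Fin (n + 1)) ℂ} (hm : m.IsHomogeneous 1)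
    (α β : ℂ) (x y : Fin (n + 1) → ℂ) :
    eval (α • x + β • y) m = α * eval x m + β * eval y m := by
  have hmem : m ∈ Submodule.span ℂ (Set.range X) := by
    rw [← homogeneousSubmodule_one_eq_span_X]
    exact hm
  obtain ⟨c, rfl⟩ := (Submodule.mem_span_range_iff_exists_fun ℂ).mp hmem
  simp only [map_sum, smul_eval, eval_X, Pi.add_apply, Pi.smul_apply, smul_eq_mul,
    Finset.mul_sum, ← Finset.sum_add_distrib]
  exact Finset.sum_congr rfl fun i _ => by ring

/-! ### Decompositions, catalecticants and partial derivatives -/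

/-- The point of affine space given by the coefficients of a linear form. -/
noncomputable def coeffVec {n : ℕ} (L : Forms n 1) : Fin (n + 1) → ℂ :=
  fun i => coeff (Finsupp.single i 1) (L : MvPolynomial (Fin (n + 1)) ℂ)

theorem eq_sum_coeffVec {n : ℕ} (L : Forms n 1) :
    (L : MvPolynomial (Fin (n + 1)) ℂ) = ∑ i, coeffVec L i • X i := by
  have hL : (L : MvPolynomial (Fin (n + 1)) ℂ) ∈ Submodule.span ℂ (Set.range X) := by
    rw [← homogeneousSubmodule_one_eq_span_X]
    exact L.2
  obtain ⟨c, hc⟩ := (Submodule.mem_span_range_iff_exists_fun ℂ).mp hL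
  have hcoeff : coeffVec L = c := by
    funext i
    simp [coeffVec, ← hc, coeff_sum, coeff_X, Finsupp.single_left_inj]
  rw [hcoeff, hc]

theorem eq_smul_of_coeffVec_eq_smul {n : ℕ} {L M : Forms n 1} {c : ℂ}
    (h : coeffVec L = c • coeffVec M) : L = c • M := by
  apply Subtype.ext
  rw [Submodule.coe_smul, eq_sum_coeffVec L, eq_sum_coeffVec M, h, Finset.smul_sum]
  simp [smul_smul]

theorem iterPartial_pow {n : ℕ} (w : List (Fin (n + 1))) (d : ℕ) (L : Forms n 1) :
    iterPartial w ((L : MvPolynomial (Fin (n + 1)) ℂ) ^ d) =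
      ((d.descFactorial w.length : ℂ) * (w.map (coeffVec L)).prod) •
        (L : MvPolynomial (Fin (n + 1)) ℂ) ^ (d - w.length) := by
  have hderiv : ∀ i, pderiv i (L : MvPolynomial (Fin (n + 1)) ℂ) = C (coeffVec L i) := fun i => by
    conv_lhs => rw [eq_sum_coeffVec L]
    simp [pderiv_X, Pi.single_apply, smul_eq_C_mul]
  induction w with
  | nil => simp [iterPartial]
  | cons i w ih =>
    change pderiv i (iterPartial w _) = _
    rw [ih, Derivation.map_smul, pderiv_pow, hderiv, List.length_cons, List.map_cons,
      List.prod_cons, Nat.descFactorial_succ, Nat.sub_sub]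
    simp only [smul_eq_C_mul, map_mul, Nat.cast_mul, map_natCast]
    ring

theorem iterPartial_sum_smul {n : ℕ} {ι : Type*} (w : List (Fin (n + 1))) (S : Finset ι)
    (c : ι → ℂ) (G : ι → MvPolynomial (Fin (n + 1)) ℂ) :
    iterPartial w (∑ i ∈ S, c i • G i) = ∑ i ∈ S, c i • iterPartial w (G i) := by
  induction w with
  | nil => rfl
  | cons i w ih =>
    change pderiv i (iterPartial w _) = ∑ j ∈ S, c j • pderiv i (iterPartial w (G j))
    simp [ih]

theorem eval_prod_map_X {n : ℕ} (w : List (Fin (n + 1))) (x : Fin (n + 1) → ℂ) :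
    eval x (w.map X).prod = (w.map x).prod := by
  simp [map_list_prod, Function.comp_def]

theorem isHomogeneous_prod_map_X {n : ℕ} (w : List (Fin (n + 1))) :
    ((w.map X).prod : MvPolynomial (Fin (n + 1)) ℂ).IsHomogeneous w.length := by
  induction w with
  | nil => exact isHomogeneous_one _ _
  | cons i w ih => simpa [add_comm] using (isHomogeneous_X ℂ i).mul ih

theorem exists_word_of_degree {n s : ℕ} {α : Fin (n + 1) →₀ ℕ} (hα : α.degree = s) :
    ∃ w : List (Fin (n + 1)), w.length = s ∧ (w.map X).prod = monomial α (1 : ℂ) := by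
  refine ⟨α.toMultiset.toList, ?_, ?_⟩
  · rw [Multiset.length_toList, Finsupp.card_toMultiset, ← hα, Finsupp.degree_eq_sum,
      Finsupp.sum_fintype _ _ (fun _ => rfl)]
    rfl
  · rw [← Multiset.prod_coe, ← Multiset.map_coe, Multiset.coe_toList, Finsupp.toMultiset_map,
      Finsupp.prod_toMultiset, monomial_eq, C_1, one_mul,
      Finsupp.prod_mapDomain_index (by simp) (by simp [pow_add])]

theorem forms_eq_span_words (n s : ℕ) : Forms n s = Submodule.span ℂ
    {G | ∃ w : List (Fin (n + 1)), w.length = s ∧ G = (w.map X).prod} := by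
  apply le_antisymm
  · rw [forms_eq_span_monomial, Submodule.span_le]
    rintro _ ⟨α, hα, rfl⟩
    obtain ⟨w, hw, hwα⟩ := exists_word_of_degree hα
    exact Submodule.subset_span ⟨w, hw, hwα.symm⟩
  · rw [Submodule.span_le]
    rintro _ ⟨w, hw, rfl⟩
    rw [← hw]
    exact isHomogeneous_prod_map_X w

namespace Decomposition

variable {n d h : ℕ} {F : MvPolynomial (Fin (n + 1)) ℂ}

/-- The map sending `Q` to `∑ λᵢ Q(Lᵢ) Lᵢ ^ (d - s)`, where `Q(Lᵢ)` is the value of `Q` at the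
coefficients of `Lᵢ`. On forms `Q` of degree `s` this is, up to the factor `d! / (d - s)!`, the
action of `Q` as a differential operator on `F` (the `s`-th catalecticant map of `F`). -/
noncomputable def catalecticant (D : Decomposition F d h) (s : ℕ) :
    MvPolynomial (Fin (n + 1)) ℂ →ₗ[ℂ] MvPolynomial (Fin (n + 1)) ℂ :=
  ∑ i, (D.coeff i • (aeval (R := ℂ) (coeffVec (D.form i))).toLinearMap).smulRight
    ((D.form i : MvPolynomial (Fin (n + 1)) ℂ) ^ (d - s))

theorem catalecticant_apply (D : Decomposition F d h) (s : ℕ)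
    (Q : MvPolynomial (Fin (n + 1)) ℂ) :
    D.catalecticant s Q = ∑ i, (D.coeff i * eval (coeffVec (D.form i)) Q) •
      (D.form i : MvPolynomial (Fin (n + 1)) ℂ) ^ (d - s) := by
  simp [catalecticant, LinearMap.sum_apply, aeval_eq_eval]

/-- A partial derivative of `F` is a value of the catalecticant map at the corresponding
monomial. -/
theorem iterPartial_eq (D : Decomposition F d h) (w : List (Fin (n + 1))) :
    iterPartial w F =
      (d.descFactorial w.length : ℂ) • D.catalecticant w.length (w.map X).prod := by
  conv_lhs => rw [D.eq_sum]
  rw [iterPartial_sum_smul, catalecticant_apply, Finset.smul_sum]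
  refine Finset.sum_congr rfl fun i _ => ?_
  rw [iterPartial_pow, eval_prod_map_X, smul_smul, smul_smul]
  congr 1
  ring

theorem map_catalecticant (D : Decomposition F d h) {s : ℕ} (hs : s ≤ d) :
    (Forms n s).map (D.catalecticant s) = partialSpan F s := by
  have hd : (d.descFactorial s : ℂ) ≠ 0 := by
    exact_mod_cast (Nat.descFactorial_pos.mpr hs).ne'
  rw [forms_eq_span_words, Submodule.map_span, partialSpan]
  apply le_antisymm
  · rw [Submodule.span_le]
    rintro _ ⟨_, ⟨w, rfl, rfl⟩, rfl⟩
    rw [SetLike.mem_coe, ← Submodule.smul_mem_iff _ hd, ← D.iterPartial_eq]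
    exact Submodule.subset_span ⟨w, rfl, rfl⟩
  · rw [Submodule.span_le]
    rintro _ ⟨w, rfl, rfl⟩
    rw [D.iterPartial_eq]
    exact Submodule.smul_mem _ _ (Submodule.subset_span ⟨_, ⟨w, rfl, rfl⟩, rfl⟩)

/-- Both sides are `1 / d!` times the number obtained by letting `Q` act on `F` as a differential
operator. -/
theorem sum_coeff_mul_eval_eq (D E : Decomposition F d h) {Q : MvPolynomial (Fin (n + 1)) ℂ}
    (hQ : Q.IsHomogeneous d) :
    ∑ i, D.coeff i * eval (coeffVec (D.form i)) Q =
      ∑ i, E.coeff i * eval (coeffVec (E.form i)) Q := by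
  have hd : (d.descFactorial d : ℂ) ≠ 0 := by
    exact_mod_cast (Nat.descFactorial_pos.mpr le_rfl).ne'
  have hQ' : Q ∈ Submodule.span ℂ
      {G | ∃ w : List (Fin (n + 1)), w.length = d ∧ G = (w.map X).prod} := by
    rw [← forms_eq_span_words]
    exact hQ
  have key : D.catalecticant d Q = E.catalecticant d Q := by
    refine LinearMap.eqOn_span ?_ hQ'
    rintro _ ⟨w, hw, rfl⟩
    have hDE := (D.iterPartial_eq w).symm.trans (E.iterPartial_eq w)
    rw [hw] at hDE
    exact smul_right_injective _ hd hDE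
  simp only [catalecticant_apply, Nat.sub_self, pow_zero, ← Finset.sum_smul] at key
  simpa using congrArg (eval 0) key

theorem catalecticant_injOn (D : Decomposition F d h) {s : ℕ} (hs : s ≤ d)
    (hdim : finrank ℂ (partialSpan F s) = (n + s).choose n)
    {Q : MvPolynomial (Fin (n + 1)) ℂ} (hQ : Q.IsHomogeneous s)
    (h0 : D.catalecticant s Q = 0) : Q = 0 := by
  have hrank := ((D.catalecticant s).domRestrict (Forms n s)).finrank_range_add_finrank_ker
  rw [LinearMap.range_domRestrict, D.map_catalecticant hs, hdim, finrank_forms,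
    Nat.add_eq_left, Submodule.finrank_eq_zero] at hrank
  have hmem : (⟨Q, hQ⟩ : Forms n s) ∈
      LinearMap.ker ((D.catalecticant s).domRestrict (Forms n s)) := by
    simpa using h0
  rw [hrank, Submodule.mem_bot] at hmem
  exact congrArg Subtype.val hmem

theorem powForm_form_ne_zero (D : Decomposition F d h) (i : Fin h) : powForm d (D.form i) ≠ 0 :=
  D.linearIndependent.ne_zero i

theorem form_ne_zero (D : Decomposition F d h) (hd : d ≠ 0) (i : Fin h) : D.form i ≠ 0 := by
  intro h0
  refine D.powForm_form_ne_zero i (Subtype.ext ?_)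
  simp [powForm, h0, hd]

theorem form_ne_smul (D : Decomposition F d h) {i j : Fin h} (hij : i ≠ j) (c : ℂ) :
    D.form i ≠ c • D.form j := by
  intro heq
  have hpow : powForm d (D.form i) = c ^ d • powForm d (D.form j) :=
    Subtype.ext (by simp [powForm, heq, smul_pow])
  refine D.linearIndependent.notMem_span_image (s := {j}) (x := i) (by simpa using hij) ?_
  rw [Set.image_singleton, hpow]
  exact Submodule.smul_mem _ _ (Submodule.mem_span_singleton_self _)

theorem coeffVec_form_ne_smul (D : Decomposition F d h) {i j : Fin h} (hij : i ≠ j) (c : ℂ) :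
    coeffVec (D.form i) ≠ c • coeffVec (D.form j) := fun heq =>
  D.form_ne_smul hij c (eq_smul_of_coeffVec_eq_smul heq)

/-- The geometric content of the two hypotheses on the span of the partial derivatives. -/
theorem noFormThroughAllButOne (D : Decomposition F d h) {s : ℕ} (hs : s ≤ d)
    (hd : d ≠ 0)
    (hdim : finrank ℂ (partialSpan F s) = (n + s).choose n)
    (hempty : partialLinearSpace F s (d - s) ∩ veronese n (d - s) = ∅) :
    NoFormThroughAllButOne s fun i => coeffVec (D.form i) := by
  intro i Q hQ hvan
  refine D.catalecticant_injOn hs hdim hQ ?_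
  have hsingle : D.catalecticant s Q = (D.coeff i * eval (coeffVec (D.form i)) Q) •
      (D.form i : MvPolynomial (Fin (n + 1)) ℂ) ^ (d - s) := by
    rw [catalecticant_apply]
    exact Finset.sum_eq_single i (fun k _ hk => by simp [hvan k hk]) (by simp)
  by_contra hne
  -- Otherwise the partial derivatives span a space containing the power of a linear form.
  have hmem : (D.form i : MvPolynomial (Fin (n + 1)) ℂ) ^ (d - s) ∈ partialSpan F s := by
    rw [← D.map_catalecticant hs]
    have hc : D.coeff i * eval (coeffVec (D.form i)) Q ≠ 0 := fun h0 =>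
      hne (by rw [hsingle, h0, zero_smul])
    rw [← Submodule.smul_mem_iff _ hc, ← hsingle]
    exact Submodule.mem_map_of_mem hQ
  have hL := D.form_ne_zero hd i
  refine Set.eq_empty_iff_forall_notMem.mp hempty
    (Projectivization.mk ℂ (powForm (d - s) (D.form i)) (powForm_ne_zero _ hL)) ⟨?_, ?_⟩
  · change Projectivization.submodule _ ≤ _
    rw [Projectivization.submodule_mk, Submodule.span_singleton_le_iff_mem]
    exact hmem
  · exact ⟨Projectivization.mk ℂ (D.form i) hL, rfl⟩

/-- Two decompositions agree as soon as they use the same points: the coefficients are then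
determined by the linear independence of the powers. -/
theorem equivalent_of_forall_exists (D E : Decomposition F d h) (hd : d ≠ 0)
    (H : ∀ i, ∃ (j : Fin h) (c : ℂ), coeffVec (D.form i) = c • coeffVec (E.form j)) :
    D.Equivalent E := by
  choose σ c hσ using H
  have hform : ∀ i, D.form i = c i • E.form (σ i) := fun i => eq_smul_of_coeffVec_eq_smul (hσ i)
  have hc : ∀ i, c i ≠ 0 := fun i h0 => D.form_ne_zero hd i (by rw [hform, h0, zero_smul])
  have hform' : ∀ i, E.form (σ i) = (c i)⁻¹ • D.form i := fun i => by
    rw [hform i, inv_smul_smul₀ (hc i)]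
  have hinj : Function.Injective σ := by
    intro i j hij
    by_contra hne
    refine D.form_ne_smul hne (c i * (c j)⁻¹) ?_
    rw [mul_smul, ← hform', ← hij, ← hform]
  let τ : Equiv.Perm (Fin h) := Equiv.ofBijective σ (Finite.injective_iff_bijective.mp hinj)
  refine ⟨τ, fun i => ⟨(c i)⁻¹, inv_ne_zero (hc i), hform' i, ?_⟩⟩
  have hsum : ∑ i, D.coeff i • powForm d (D.form i) =
      ∑ i, (E.coeff (τ i) * (c i)⁻¹ ^ d) • powForm d (D.form i) := by
    apply Subtype.ext
    have hE := E.eq_sum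
    rw [← Equiv.sum_comp τ] at hE
    simp only [Submodule.coe_sum, Submodule.coe_smul, powForm]
    refine D.eq_sum.symm.trans (hE.trans ?_)
    refine Finset.sum_congr rfl fun i _ => ?_
    rw [show E.form (τ i) = (c i)⁻¹ • D.form i from hform' i, Submodule.coe_smul, smul_pow,
      smul_smul]
  have hli := Fintype.linearIndependent_iff.mp D.linearIndependent
    (fun i => D.coeff i - E.coeff (τ i) * (c i)⁻¹ ^ d)
    (by simp only [sub_smul, Finset.sum_sub_distrib, hsum, sub_self]) i
  exact sub_eq_zero.mp hli

end Decomposition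

/-! ### Binary forms of odd degree -/

/-- The `2 * h` points of two decompositions of length `h` in degree `2 * h - 1` coincide, in any
number of variables. -/
theorem eq_smul_of_relation_of_two_mul {n d h : ℕ} (hd : d + 1 = 2 * h)
    {p q : Fin h → Fin (n + 1) → ℂ} {a b : Fin h → ℂ} (hb : ∀ j, b j ≠ 0)
    (hq : ∀ j k, j ≠ k → ∀ c : ℂ, q j ≠ c • q k)
    (hrel : ∀ D : MvPolynomial (Fin (n + 1)) ℂ, D.IsHomogeneous d →
      ∑ i, a i * eval (p i) D = ∑ j, b j * eval (q j) D) (j : Fin h) :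
    ∃ (i : Fin h) (c : ℂ), q j = c • p i := by
  classical
  by_contra! hne
  choose l hl hlp hlq using fun i => exists_linear_form_separating (hne i)
  choose m hm hmq hmj using fun k : {k // k ≠ j} =>
    exists_linear_form_separating (hq j k k.2.symm)
  -- The product of all these `2 * h - 1` linear forms vanishes at all points but `q j`.
  set D := (∏ i, l i) * ∏ k, m k with hDdef
  have hD : D.IsHomogeneous d := by
    have h1 := IsHomogeneous.prod Finset.univ l _ fun i _ => hl i
    have h2 := IsHomogeneous.prod Finset.univ m _ fun k _ => hm k
    have h12 := h1.mul h2
    have hpos := j.pos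
    simp only [Finset.sum_const, Finset.card_univ, Fintype.card_fin, smul_eq_mul, mul_one,
      Fintype.card_subtype_compl, Fintype.card_subtype_eq] at h12
    rwa [show h + (h - 1) = d by omega] at h12
  have hDp : ∀ i, eval (p i) D = 0 := fun i => by
    rw [hDdef, map_mul, map_prod, Finset.prod_eq_zero (Finset.mem_univ i) (hlp i), zero_mul]
  have hDq : ∀ k, k ≠ j → eval (q k) D = 0 := fun k hk => by
    rw [hDdef, map_mul, map_prod _ m,
      Finset.prod_eq_zero (Finset.mem_univ (⟨k, hk⟩ : {k // k ≠ j})) (hmq ⟨k, hk⟩),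
      mul_zero]
  have hDj : eval (q j) D ≠ 0 := by
    rw [hDdef, map_mul, map_prod, map_prod]
    exact mul_ne_zero (Finset.prod_ne_zero_iff.mpr fun i _ => hlq i)
      (Finset.prod_ne_zero_iff.mpr fun k _ => hmj k)
  have hsum := hrel D hD
  rw [Finset.sum_eq_zero fun i _ => by rw [hDp, mul_zero],
    Finset.sum_eq_single j (fun k _ hk => by rw [hDq k hk, mul_zero]) (by simp)] at hsum
  exact mul_ne_zero (hb j) hDj hsum.symm

/-! ### Cubics in four variables -/

/-- The line through any two of the points `q` contains two of the points `p`. -/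
theorem exists_pair_mem_line {p q : Fin 5 → Fin 4 → ℂ} {a b : Fin 5 → ℂ}
    (ha : ∀ i, a i ≠ 0)
    (hp : NoFormThroughAllButOne (n := 3) 1 p)
    (hrel : ∀ D : MvPolynomial (Fin 4) ℂ, D.IsHomogeneous 3 →
      ∑ i, a i * eval (p i) D = ∑ j, b j * eval (q j) D)
    {j k : Fin 5} (hjk : j ≠ k) :
    ∃ i i' : Fin 5, i ≠ i' ∧ (∃ α β : ℂ, p i = α • q j + β • q k) ∧
      ∃ α β : ℂ, p i' = α • q j + β • q k := by
  obtain ⟨l, hl, hl0, hlv⟩ := exists_form_vanishing (n := 3) 1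
    (fun t : {t : Fin 5 // t ∉ ({j, k} : Finset (Fin 5))} => q t) (by
      simp only [Fintype.card_subtype_compl, Fintype.card_fin, Fintype.card_coe,
        Finset.card_pair hjk]
      decide)
  -- For `m` through `q j` and `q k`, the product `l * m` vanishes at all the points `q`.
  have hlin : ∀ m : MvPolynomial (Fin 4) ℂ, m.IsHomogeneous 1 → eval (q j) m = 0 →
      eval (q k) m = 0 → ∀ m' : MvPolynomial (Fin 4) ℂ, m'.IsHomogeneous 1 →
      ∑ i, (a i * eval (p i) l * eval (p i) m) * eval (p i) m' = 0 := by
    intro m hm hmj hmk m' hm'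
    have hR := hrel (l * m * m') ((hl.mul hm).mul hm')
    rw [Finset.sum_eq_zero (s := Finset.univ) (f := fun t => b t * _)] at hR
    · rw [← hR]
      refine Finset.sum_congr rfl fun i _ => ?_
      simp only [map_mul]
      ring
    · intro t _
      simp only [map_mul]
      by_cases h1 : t = j
      · simp [h1, hmj]
      by_cases h2 : t = k
      · simp [h2, hmk]
      · simp [hlv ⟨t, by simp [h1, h2]⟩]
  -- If `l` missed all the points `p`, a plane through `q j`, `q k` and `p 0` would contain them all.
  obtain ⟨i₀, hi₀⟩ : ∃ i, eval (p i) l = 0 := by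
    by_contra! hne
    obtain ⟨m, hm, hm0, hmv⟩ := exists_form_vanishing (n := 3) 1 ![q j, q k, p 0] (by decide)
    have hz := hp.coeff_eq_zero (by decide) (hlin m hm (hmv 0) (hmv 1)) (k := 0)
      (by simpa using Or.inr (hmv 2))
    refine hm0 (hp 0 m hm fun i _ => ?_)
    exact (mul_eq_zero.mp (hz i)).resolve_left (mul_ne_zero (ha i) (hne i))
  have hline : ∀ i, eval (p i) l ≠ 0 → ∃ α β : ℂ, p i = α • q j + β • q k := fun i hi => by
    refine exists_eq_smul_add_smul (n := 3) fun m hm hmj hmk => ?_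
    have hz := hp.coeff_eq_zero (by decide) (hlin m hm hmj hmk) (k := i₀) (by simp [hi₀]) i
    exact (mul_eq_zero.mp hz).resolve_left (mul_ne_zero (ha i) hi)
  have hex : ∀ i, ∃ i', i' ≠ i ∧ eval (p i') l ≠ 0 := fun i => by
    by_contra! hne
    exact hl0 (hp i l hl hne)
  obtain ⟨i, -, hi⟩ := hex 0
  obtain ⟨i', hii', hi'⟩ := hex i
  exact ⟨i, i', hii'.symm, hline i hi, hline i' hi'⟩

/-- Uniqueness of the points of a pentahedral decomposition of a cubic surface: each `q j` is the
common point of two lines, each of which joins two of the points `p`. -/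
theorem eq_smul_of_relation_three_three {p q : Fin 5 → Fin 4 → ℂ} {a b : Fin 5 → ℂ}
    (ha : ∀ i, a i ≠ 0)
    (hp : NoFormThroughAllButOne (n := 3) 1 p) (hq : NoFormThroughAllButOne (n := 3) 1 q)
    (hrel : ∀ D : MvPolynomial (Fin 4) ℂ, D.IsHomogeneous 3 →
      ∑ i, a i * eval (p i) D = ∑ j, b j * eval (q j) D) (j : Fin 5) :
    ∃ (i : Fin 5) (c : ℂ), q j = c • p i := by
  obtain ⟨k, k', t, hjk, hjk', hkk', htj, htk, htk', hall⟩ : ∃ k k' t : Fin 5, j ≠ k ∧ j ≠ k' ∧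
      k ≠ k' ∧ t ≠ j ∧ t ≠ k ∧ t ≠ k' ∧ ∃ u, ∀ x, x ≠ u → x = j ∨ x = k ∨ x = k' ∨ x = t := by
    revert j; decide
  obtain ⟨u, hu⟩ := hall
  -- Four of the points `q` span the space, hence `q j`, `q k`, `q k'` are independent.
  have hindep : ∀ m : MvPolynomial (Fin 4) ℂ, m.IsHomogeneous 1 → eval (q t) m = 0 →
      eval (q j) m = 0 → eval (q k) m = 0 → eval (q k') m = 0 → m = 0 :=
    fun m hm h1 h2 h3 h4 => hq u m hm fun x hx => by
      rcases hu x hx with rfl | rfl | rfl | rfl <;> assumption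
  obtain ⟨x, y, hxy, ⟨α, β, hx⟩, α', β', hy⟩ := exists_pair_mem_line ha hp hrel hjk
  obtain ⟨z, w, hzw, ⟨γ, δ, hz⟩, γ', δ', hw⟩ := exists_pair_mem_line ha hp hrel hjk'
  obtain ⟨e, ⟨ε, ζ, h1⟩, η, θ, h2⟩ : ∃ e, (∃ α β : ℂ, p e = α • q j + β • q k) ∧
      ∃ α β : ℂ, p e = α • q j + β • q k' := by
    by_contra! hne
    -- Two disjoint pairs would give four points `p` in the plane of `q j`, `q k`, `q k'`.
    obtain ⟨m, hm, hm0, hmv⟩ := exists_form_vanishing (n := 3) 1 ![q j, q k, q k'] (by decide)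
    have mj : eval (q j) m = 0 := hmv 0
    have mk : eval (q k) m = 0 := hmv 1
    have mk' : eval (q k') m = 0 := hmv 2
    have hxz : x ≠ z := by rintro rfl; exact hne x ⟨α, β, hx⟩ γ δ hz
    have hxw : x ≠ w := by rintro rfl; exact hne x ⟨α, β, hx⟩ γ' δ' hw
    have hyz : y ≠ z := by rintro rfl; exact hne y ⟨α', β', hy⟩ γ δ hz
    have hyw : y ≠ w := by rintro rfl; exact hne y ⟨α', β', hy⟩ γ' δ' hw
    obtain ⟨v, hv⟩ : ∃ v, ∀ r, r ≠ v → r = x ∨ r = y ∨ r = z ∨ r = w := by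
      clear hx hy hz hw hne
      revert x y z w; decide
    refine hm0 (hp v m hm fun r hr => ?_)
    rcases hv r hr with rfl | rfl | rfl | rfl
    · rw [hx, eval_smul_add_smul (n := 3) hm, mj, mk]; simp
    · rw [hy, eval_smul_add_smul (n := 3) hm, mj, mk]; simp
    · rw [hz, eval_smul_add_smul (n := 3) hm, mj, mk']; simp
    · rw [hw, eval_smul_add_smul (n := 3) hm, mj, mk']; simp
  have hζ : ζ = 0 := by
    by_contra hζ
    obtain ⟨m, hm, hm0, hmv⟩ := exists_form_vanishing (n := 3) 1 ![q j, q k', q t] (by decide)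
    have mj : eval (q j) m = 0 := hmv 0
    have mk' : eval (q k') m = 0 := hmv 1
    have mt : eval (q t) m = 0 := hmv 2
    have e1 := congrArg (fun v => eval v m) (h1.symm.trans h2)
    simp only [eval_smul_add_smul (n := 3) hm, mj, mk', mul_zero, zero_add] at e1
    exact hm0 (hindep m hm mt mj ((mul_eq_zero.mp e1).resolve_left hζ) mk')
  have hpe : p e = ε • q j := by rw [h1, hζ, zero_smul, add_zero]
  have hε : ε ≠ 0 := fun h0 =>
    hp.ne_zero (by decide) one_ne_zero e (by rw [hpe, h0, zero_smul])
  exact ⟨e, ε⁻¹, by rw [hpe, inv_smul_smul₀ hε]⟩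

/-! ### Linear syzygies and common factors -/

/-- Points separated by forms of degree `e` impose independent conditions on such forms. -/
theorem eval_forms_surjective {n h e : ℕ} {p : Fin h → Fin (n + 1) → ℂ}
    (hsep : ∀ i, ∃ D : MvPolynomial (Fin (n + 1)) ℂ, D.IsHomogeneous e ∧ eval (p i) D ≠ 0 ∧
      ∀ k, k ≠ i → eval (p k) D = 0) :
    Function.Surjective (LinearMap.pi fun i => formEval e (p i)) := by
  intro v
  choose D hD hDi hDk using hsep
  refine ⟨∑ i, (v i / eval (p i) (D i)) • ⟨D i, hD i⟩, funext fun k => ?_⟩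
  rw [map_sum, Finset.sum_apply, Finset.sum_eq_single k]
  · simp [hDi k]
  · intro i _ hik
    simp [hDk i k hik.symm]
  · simp

/-- Multiplication by a fixed form of degree `e`, from linear forms to forms of degree `e + 1`. -/
noncomputable def mulLinear {n e : ℕ} (A : Forms n e) : Forms n 1 →ₗ[ℂ] Forms n (e + 1) :=
  (LinearMap.mulLeft ℂ (A : MvPolynomial (Fin (n + 1)) ℂ)).restrict fun _ hl =>
    IsHomogeneous.mul A.2 hl

/-- If the points `p i` impose independent conditions on forms of degree `e + 1`, then `r` forms
of degree `e` through these points have a linear syzygy as soon as `r * (n + 1)` exceeds the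
dimension of the space of forms of degree `e + 1` through the points. -/
theorem exists_linear_syzygy {n h e r : ℕ} {p : Fin h → Fin (n + 1) → ℂ}
    (hsep : ∀ i, ∃ D : MvPolynomial (Fin (n + 1)) ℂ, D.IsHomogeneous (e + 1) ∧
      eval (p i) D ≠ 0 ∧ ∀ k, k ≠ i → eval (p k) D = 0)
    (hcard : (n + (e + 1)).choose n < h + r * (n + 1))
    {A : Fin r → MvPolynomial (Fin (n + 1)) ℂ} (hA : ∀ j, (A j).IsHomogeneous e)
    (hAp : ∀ j i, eval (p i) (A j) = 0) :
    ∃ l : Fin r → MvPolynomial (Fin (n + 1)) ℂ, (∀ j, (l j).IsHomogeneous 1) ∧ l ≠ 0 ∧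
      ∑ j, A j * l j = 0 := by
  set ev := LinearMap.pi fun i => formEval (e + 1) (p i)
  let T : (Fin r → Forms n 1) →ₗ[ℂ] Forms n (e + 1) :=
    ∑ j, mulLinear ⟨A j, hA j⟩ ∘ₗ LinearMap.proj j
  have hT : ∀ l, (T l : MvPolynomial (Fin (n + 1)) ℂ) = ∑ j, A j * l j := fun l => by
    simp only [T, LinearMap.sum_apply, Submodule.coe_sum]
    rfl
  have hle : LinearMap.range T ≤ LinearMap.ker ev := by
    rintro _ ⟨l, rfl⟩
    refine LinearMap.mem_ker.mpr (funext fun i => ?_)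
    simp [ev, hT, hAp]
  have h1 := Submodule.finrank_mono hle
  have h2 := ev.finrank_range_add_finrank_ker
  rw [LinearMap.range_eq_top.mpr (eval_forms_surjective hsep), finrank_top,
    finrank_fintype_fun_eq_card, Fintype.card_fin, finrank_forms] at h2
  have h3 := T.finrank_range_add_finrank_ker
  rw [finrank_pi_fintype, Finset.sum_const, finrank_forms, Finset.card_univ, Fintype.card_fin,
    smul_eq_mul, Nat.choose_succ_self_right] at h3
  have hker : LinearMap.ker T ≠ ⊥ := fun h0 => by
    rw [h0, finrank_bot] at h3
    omega
  obtain ⟨l, hl, hl0⟩ := Submodule.exists_mem_ne_zero_of_ne_bot hker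
  refine ⟨fun j => l j, fun j => (l j).2, fun h0 => hl0 (funext fun j => Subtype.ext ?_), ?_⟩
  · exact congrFun h0 j
  · rw [← hT, LinearMap.mem_ker.mp hl, Submodule.coe_zero]

theorem prime_of_isHomogeneous_one {n : ℕ} {l : MvPolynomial (Fin (n + 1)) ℂ}
    (hl : l.IsHomogeneous 1) (h0 : l ≠ 0) : Prime l := by
  refine (irreducible_of_totalDegree_eq_one (hl.totalDegree h0) fun x hx => ?_).prime
  refine isUnit_iff_ne_zero.mpr ?_
  rintro rfl
  exact h0 (MvPolynomial.ext _ _ fun i => by simpa using hx i)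

/-- A form of degree `e + m` divisible by a form of degree `m` has a quotient which is a form. -/
theorem exists_isHomogeneous_quotient {n m e : ℕ} {l A : MvPolynomial (Fin (n + 1)) ℂ}
    (hl : l.IsHomogeneous m) (hA : A.IsHomogeneous (m + e)) (h : l ∣ A) :
    ∃ G : MvPolynomial (Fin (n + 1)) ℂ, G.IsHomogeneous e ∧ A = l * G := by
  obtain ⟨G, rfl⟩ := h
  let _ := gradedAlgebra (σ := Fin (n + 1)) (R := ℂ)
  refine ⟨_, (DirectSum.decompose (Forms n) G e).2, ?_⟩
  rw [← DirectSum.coe_decompose_mul_add_of_left_mem (Forms n) hl,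
    DirectSum.decompose_of_mem_same (Forms n) hA]

/-- Two linearly independent forms with a nontrivial linear syzygy share a factor of degree one
less, and the coefficients of the syzygy are not proportional. -/
theorem exists_common_factor_of_linear_syzygy {n e : ℕ} {A₁ A₂ l m : MvPolynomial (Fin (n + 1)) ℂ}
    (hA₂ : A₂.IsHomogeneous (1 + e)) (hA₂0 : A₂ ≠ 0) (hind : ∀ c : ℂ, A₁ ≠ C c * A₂)
    (hl : l.IsHomogeneous 1) (hm : m.IsHomogeneous 1) (hne : l ≠ 0 ∨ m ≠ 0)
    (hsyz : A₁ * l + A₂ * m = 0) :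
    ∃ G : MvPolynomial (Fin (n + 1)) ℂ, G.IsHomogeneous e ∧ A₂ = l * G ∧ A₁ = -(m * G) ∧
      ¬ ∃ c : ℂ, m = C c * l := by
  have hl0 : l ≠ 0 := by
    rintro rfl
    rw [mul_zero, zero_add] at hsyz
    exact hne.elim (fun h => h rfl) fun h => mul_ne_zero hA₂0 h hsyz
  have hml : ¬ ∃ c : ℂ, m = C c * l := by
    rintro ⟨c, rfl⟩
    refine hind (-c) (mul_right_cancel₀ hl0 ?_)
    rw [C_neg]
    linear_combination hsyz
  have hlm : ¬ l ∣ m := fun hdvd => by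
    obtain ⟨c, hc, rfl⟩ := exists_isHomogeneous_quotient (e := 0) hl hm hdvd
    obtain ⟨r, rfl⟩ : ∃ r, c = C r :=
      ⟨_, totalDegree_eq_zero_iff_eq_C.mp (Nat.le_zero.mp hc.totalDegree_le)⟩
    exact hml ⟨r, mul_comm _ _⟩
  have hdvd : l ∣ A₂ * m := ⟨-A₁, by linear_combination hsyz⟩
  obtain ⟨G, hG, rfl⟩ := exists_isHomogeneous_quotient hl hA₂
    (((prime_of_isHomogeneous_one hl hl0).dvd_or_dvd hdvd).resolve_right hlm)
  refine ⟨G, hG, rfl, mul_right_cancel₀ hl0 ?_, hml⟩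
  linear_combination hsyz

/-- In the plane, two non-proportional lines do not share two distinct points. -/
theorem not_vanish_at_two_points {l m : MvPolynomial (Fin 3) ℂ} (hl : l.IsHomogeneous 1)
    (hm : m.IsHomogeneous 1) (hl0 : l ≠ 0) (hml : ¬ ∃ c : ℂ, m = C c * l) {x y : Fin 3 → ℂ}
    (hxy : ∀ c : ℂ, x ≠ c • y) (hyx : ∀ c : ℂ, y ≠ c • x)
    (hlx : eval x l = 0) (hly : eval y l = 0) (hmx : eval x m = 0) (hmy : eval y m = 0) :
    False := by
  have hsurj : Function.Surjective (LinearMap.pi fun i => formEval (n := 2) 1 (![x, y] i)) := by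
    refine eval_forms_surjective (n := 2) (h := 2) fun i => ?_
    fin_cases i
    · obtain ⟨D, hD, h1, h2⟩ := exists_linear_form_separating (n := 2) hxy
      exact ⟨D, hD, h2, fun k hk => by fin_cases k <;> simp_all⟩
    · obtain ⟨D, hD, h1, h2⟩ := exists_linear_form_separating (n := 2) hyx
      exact ⟨D, hD, h2, fun k hk => by fin_cases k <;> simp_all⟩
  have hrank :=
    (LinearMap.pi fun i => formEval (n := 2) 1 (![x, y] i)).finrank_range_add_finrank_ker
  rw [LinearMap.range_eq_top.mpr hsurj, finrank_top, finrank_fintype_fun_eq_card,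
    Fintype.card_fin, finrank_forms] at hrank
  have hone : finrank ℂ
      (LinearMap.ker (LinearMap.pi fun i => formEval (n := 2) 1 (![x, y] i))) = 1 := by
    have : (2 + 1).choose 2 = 3 := by decide
    omega
  let l' : LinearMap.ker (LinearMap.pi fun i => formEval (n := 2) 1 (![x, y] i)) :=
    ⟨⟨l, hl⟩, LinearMap.mem_ker.mpr (funext fun i => by fin_cases i <;> simp [hlx, hly])⟩
  have hl' : l' ≠ 0 := fun h0 => hl0 (congrArg Subtype.val (congrArg Subtype.val h0))
  obtain ⟨c, hc⟩ := (finrank_eq_one_iff_of_nonzero' l' hl').mp hone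
    ⟨⟨m, hm⟩, LinearMap.mem_ker.mpr (funext fun i => by fin_cases i <;> simp [hmx, hmy])⟩
  refine hml ⟨c, ?_⟩
  rw [← smul_eq_C_mul]
  exact (congrArg Subtype.val (congrArg Subtype.val hc)).symm

/-! ### Plane quintics -/

/-- If the forms of degree `s + 1` through the points `p i` all vanish at `q`, then `q` is one of
these points. -/
theorem NoFormThroughAllButOne.eq_smul_of_vanishing {n h s : ℕ} {p : Fin h → Fin (n + 1) → ℂ}
    (hp : NoFormThroughAllButOne s p) (hcard : h = (n + s).choose n + 1) (hs : s ≠ 0)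
    (hn : 2 ≤ n) {q : Fin (n + 1) → ℂ}
    (hq : ∀ D : MvPolynomial (Fin (n + 1)) ℂ, D.IsHomogeneous (s + 1) →
      (∀ i, eval (p i) D = 0) → eval q D = 0) :
    ∃ (i : Fin h) (c : ℂ), q = c • p i := by
  by_contra! hne
  obtain ⟨c, hc⟩ := exists_eval_eq_sum_of_vanishing hq
  obtain ⟨j, hj⟩ : ∃ j, c j ≠ 0 := by
    by_contra! h0
    refine hne ⟨0, by omega⟩ 0 (funext fun t => ?_)
    have ht := hc (X t ^ (s + 1)) (by simpa using (isHomogeneous_X ℂ t).pow (s + 1))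
    simpa [h0] using ht
  -- Any `p k` is on the line through `q` and `p j`: test the relation on the product of a linear
  -- form through `q` and `p k` with a form of degree `s` through all points but `p j` and `p k`.
  have hline : ∀ k, k ≠ j → ∃ α β : ℂ, p j = α • q + β • p k := fun k hk => by
    refine exists_eq_smul_add_smul fun l hl hlq hlk => ?_
    obtain ⟨Q, hQ, hQj, hQv⟩ := hp.exists_isolating_form hcard hk.symm
    have hsum := hc (Q * l) (hQ.mul hl)
    rw [map_mul, hlq, mul_zero, Finset.sum_eq_single j] at hsum
    · rw [map_mul] at hsum
      simpa [hj, hQj] using hsum.symm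
    · intro i _ hij
      by_cases hik : i = k
      · simp [hik, hlk]
      · simp [hQv i hij hik]
    · simp
  obtain ⟨l, hl, hl0, hlv⟩ := exists_form_vanishing 1 ![q, p j] (by
    rw [Fintype.card_fin, Nat.choose_succ_self_right]
    omega)
  have hlq : eval q l = 0 := hlv 0
  have hlj : eval (p j) l = 0 := hlv 1
  refine pow_ne_zero s hl0 (hp j (l ^ s) (by simpa using hl.pow s) fun k hk => ?_)
  obtain ⟨α, β, hαβ⟩ := hline k hk
  have hβ : β ≠ 0 := by
    rintro rfl
    rw [zero_smul, add_zero] at hαβ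
    have hα : α ≠ 0 := fun h0 => hp.ne_zero hcard hs j (by rw [hαβ, h0, zero_smul])
    exact hne j α⁻¹ (by rw [hαβ, inv_smul_smul₀ hα])
  have hev := congrArg (fun x => eval x l) hαβ
  simp only [eval_smul_add_smul hl, hlq, hlj, mul_zero, zero_add] at hev
  rw [map_pow, (mul_eq_zero.mp hev.symm).resolve_left hβ, zero_pow hs]

/-- Uniqueness of the seven points of a decomposition of a plane quintic. -/
theorem eq_smul_of_relation_two_five {p q : Fin 7 → Fin 3 → ℂ} {a b : Fin 7 → ℂ}
    (hb : ∀ j, b j ≠ 0)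
    (hp : NoFormThroughAllButOne (n := 2) 2 p) (hq : NoFormThroughAllButOne (n := 2) 2 q)
    (hpp : ∀ i k, i ≠ k → ∀ c : ℂ, p i ≠ c • p k)
    (hrel : ∀ D : MvPolynomial (Fin 3) ℂ, D.IsHomogeneous 5 →
      ∑ i, a i * eval (p i) D = ∑ j, b j * eval (q j) D) (j : Fin 7) :
    ∃ (i : Fin 7) (c : ℂ), q j = c • p i := by
  by_contra hj
  obtain ⟨B, hB, hBp, hBj⟩ : ∃ B : MvPolynomial (Fin 3) ℂ, B.IsHomogeneous 3 ∧
      (∀ i, eval (p i) B = 0) ∧ eval (q j) B ≠ 0 := by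
    by_contra! hvan
    exact hj (hp.eq_smul_of_vanishing (n := 2) (by decide) two_ne_zero le_rfl hvan)
  -- A cubic through the points `p` yields a relation on conics supported on the points `q`.
  have hconic : ∀ A : MvPolynomial (Fin 3) ℂ, A.IsHomogeneous 3 → (∀ i, eval (p i) A = 0) →
      ∀ Q : MvPolynomial (Fin 3) ℂ, Q.IsHomogeneous 2 →
        ∑ k, (b k * eval (q k) A) * eval (q k) Q = 0 := by
    intro A hA hAp Q hQ
    have hR := hrel (A * Q) (hA.mul hQ)
    rw [Finset.sum_eq_zero fun i _ => by rw [map_mul, hAp, zero_mul, mul_zero]] at hR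
    rw [hR]
    exact Finset.sum_congr rfl fun k _ => by rw [map_mul, mul_assoc]
  have hall : ∀ A : MvPolynomial (Fin 3) ℂ, A.IsHomogeneous 3 → (∀ i, eval (p i) A = 0) →
      ∀ k, eval (q k) A = 0 → ∀ t, eval (q t) A = 0 := by
    intro A hA hAp k hk t
    have hz := hq.coeff_eq_zero (by decide) (hconic A hA hAp) (k := k) (by rw [hk, mul_zero]) t
    exact (mul_eq_zero.mp hz).resolve_left (hb t)
  have hBq : ∀ k, eval (q k) B ≠ 0 := fun k hk => hBj (hall B hB hBp k hk j)
  -- Two independent cubics through the points `p` and `q 0`, hence through all the points `q`.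
  obtain ⟨A₁, hA₁, hA₁0, hA₁v⟩ := exists_form_vanishing (n := 2) 3
    (fun o : Option (Fin 7) => o.elim (q 0) p) (by decide)
  obtain ⟨u, hu⟩ : ∃ u, eval u A₁ ≠ 0 := by
    by_contra! hz
    exact hA₁0 (hA₁.eq_zero_of_forall_eval_eq_zero hz)
  obtain ⟨A₂, hA₂, hA₂0, hA₂v⟩ := exists_form_vanishing (n := 2) 3
    (fun o : Option (Option (Fin 7)) => o.elim u fun o' => o'.elim (q 0) p) (by decide)
  have hA₁p : ∀ i, eval (p i) A₁ = 0 := fun i => hA₁v (some i)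
  have hA₂p : ∀ i, eval (p i) A₂ = 0 := fun i => hA₂v (some (some i))
  have hA₁q := hall A₁ hA₁ hA₁p 0 (hA₁v none)
  have hA₂q := hall A₂ hA₂ hA₂p 0 (hA₂v (some none))
  have hA₂u : eval u A₂ = 0 := hA₂v none
  -- Two conics, missing different points besides `p i`, give a quartic that isolates `p i`.
  have hsep : ∀ i, ∃ D : MvPolynomial (Fin 3) ℂ, D.IsHomogeneous (3 + 1) ∧
      eval (p i) D ≠ 0 ∧ ∀ k, k ≠ i → eval (p k) D = 0 := by
    intro i
    obtain ⟨k, k', hik, hik', hkk'⟩ : ∃ k k' : Fin 7, i ≠ k ∧ i ≠ k' ∧ k ≠ k' := by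
      revert i; decide
    obtain ⟨Q, hQ, hQi, hQv⟩ := hp.exists_isolating_form (by decide) hik
    obtain ⟨Q', hQ', hQi', hQv'⟩ := hp.exists_isolating_form (by decide) hik'
    refine ⟨Q * Q', hQ.mul hQ', by rw [map_mul]; exact mul_ne_zero hQi hQi', fun t ht => ?_⟩
    by_cases htk : t = k
    · rw [map_mul, hQv' t ht (htk ▸ hkk'), mul_zero]
    · rw [map_mul, hQv t ht htk, zero_mul]
  -- Quartics through the seven points form a space of dimension `15 - 7 = 8 < 3 * 3`.
  obtain ⟨l, hl, hl0, hsyz⟩ := exists_linear_syzygy (n := 2) (e := 3) hsep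
    (show (2 + (3 + 1)).choose 2 < 7 + 3 * (2 + 1) by decide) (A := ![A₁, A₂, B])
    (fun t => by fin_cases t <;> assumption) (fun t i => by
      fin_cases t
      exacts [hA₁p i, hA₂p i, hBp i])
  simp only [Fin.sum_univ_three, Matrix.cons_val_zero, Matrix.cons_val_one, Matrix.cons_val] at hsyz
  have hl2 : l 2 = 0 := by
    have hsq : l 2 ^ 2 = 0 := hq 0 _ (by simpa using (hl 2).pow 2) fun k _ => by
      have hk := congrArg (eval (q k)) hsyz
      simp only [map_add, map_mul, hA₁q k, hA₂q k, zero_mul, zero_add, map_zero] at hk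
      rw [map_pow, (mul_eq_zero.mp hk).resolve_left (hBq k), zero_pow two_ne_zero]
    exact pow_eq_zero_iff two_ne_zero |>.mp hsq
  rw [hl2, mul_zero, add_zero] at hsyz
  obtain ⟨G, hG, hA₂G, hA₁G, hml⟩ := exists_common_factor_of_linear_syzygy (n := 2) (e := 2) hA₂
    hA₂0 (fun c hc => hu (by rw [hc, map_mul, hA₂u, mul_zero])) (hl 0) (hl 1) (by
      by_contra! hz
      exact hl0 (funext fun t => by fin_cases t; exacts [hz.1, hz.2, hl2])) hsyz
  have hG0 : G ≠ 0 := fun h0 => hA₂0 (by rw [hA₂G, h0, mul_zero])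
  have hl00 : l 0 ≠ 0 := fun h0 => hA₂0 (by rw [hA₂G, h0, zero_mul])
  -- The conic `G` misses at least two of the points, where both lines `l 0` and `l 1` pass.
  have hmiss : ∀ i, ∃ k, k ≠ i ∧ eval (p k) G ≠ 0 := fun i => by
    by_contra! hz
    exact hG0 (hp i G hG hz)
  obtain ⟨i, -, hi⟩ := hmiss 0
  obtain ⟨k, hki, hk⟩ := hmiss i
  have hl0p : ∀ t, eval (p t) G ≠ 0 → eval (p t) (l 0) = 0 := fun t ht => by
    have := hA₂p t
    rw [hA₂G, map_mul] at this
    exact (mul_eq_zero.mp this).resolve_right ht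
  have hl1p : ∀ t, eval (p t) G ≠ 0 → eval (p t) (l 1) = 0 := fun t ht => by
    have := hA₁p t
    rw [hA₁G, map_neg, map_mul, neg_eq_zero] at this
    exact (mul_eq_zero.mp this).resolve_right ht
  exact not_vanish_at_two_points (hl 0) (hl 1) hl00 hml (hpp i k hki.symm) (hpp k i hki)
    (hl0p i hi) (hl0p k hk) (hl1p i hi) (hl1p k hk)

end WaringIdentifiability

open WaringIdentifiability in
theorem theorem3p7 (n d h s : ℕ)
    (hcase : (n = 1 ∧ d + 1 = 2 * h ∧ h = s + 2) ∨
      (n = 2 ∧ d = 5 ∧ h = 7 ∧ s = 2) ∨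
      (n = 3 ∧ d = 3 ∧ h = 5 ∧ s = 1))
    (F : MvPolynomial (Fin (n + 1)) ℂ) (hF : F.IsHomogeneous d)
    (hdec : Nonempty (WaringIdentifiability.Decomposition F d h))
    (hdim : Module.finrank ℂ (WaringIdentifiability.partialSpan F s) = (n + s).choose n)
    (hempty : WaringIdentifiability.partialLinearSpace F s (d - s) ∩
      WaringIdentifiability.veronese n (d - s) = ∅) :
    WaringIdentifiability.IsIdentifiable F d h := by
  refine ⟨hdec, fun D E => ?_⟩
  have hd : d ≠ 0 := by omega
  have hs : s ≤ d := by omega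
  refine D.equivalent_of_forall_exists E hd ?_
  have hD := D.noFormThroughAllButOne hs hd hdim hempty
  have hE := E.noFormThroughAllButOne hs hd hdim hempty
  have hrel : ∀ Q : MvPolynomial (Fin (n + 1)) ℂ, Q.IsHomogeneous d →
      ∑ i, E.coeff i * MvPolynomial.eval (coeffVec (E.form i)) Q =
        ∑ i, D.coeff i * MvPolynomial.eval (coeffVec (D.form i)) Q :=
    fun Q hQ => E.sum_coeff_mul_eval_eq D hQ
  rcases hcase with ⟨rfl, hdh, rfl⟩ | ⟨rfl, rfl, rfl, rfl⟩ | ⟨rfl, rfl, rfl, rfl⟩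
  · exact eq_smul_of_relation_of_two_mul hdh D.coeff_ne_zero
      (fun i j hij => D.coeffVec_form_ne_smul hij) hrel
  · exact eq_smul_of_relation_two_five D.coeff_ne_zero hE hD
      (fun i j hij => E.coeffVec_form_ne_smul hij) hrel
  · exact eq_smul_of_relation_three_three E.coeff_ne_zero hE hD hrel
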